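/- All manifolds are real, finite-dimensional, Hausdorff, second countable, smooth and without boundary. A principal $\mathbb R$-bundle is a smooth map $\mu:A\to V$ together with a smooth action $\psi:\mathbb R\times A\to A$ of $(\mathbb R,+)$ with $\mu\circ\psi_s=\mu$ for all $s$, such that every point of $V$ has an open neighbourhood $U$ with a diffeomorphism $\mu^{-1}(U)\to U\times\mathbb R$ of the form $a\mapsto(\mu(a),\tau(a))$, where $\tau(\psi_s(a))=s+\tau(a)$. A symplectic principal $\mathbb R$-bundle $\mu:(A,\Omega)\to V$ is a principal $\mathbb R$-bundle with a symplectic form $\Omega$ (a smooth closed nondegenerate $2$-form) on $A$ such that $\psi_s^*\Omega=\Omega$ for all $s\in\mathbb R$. The Poisson bracket induced by $\Omega$ is $\{g,g'\}_A=\Omega(\mathcal H_g,\mathcal H_{g'})$ for $g,g'\in C^\infty(A)$, where $i_{\mathcal H_g}\Omega=dg$. A Poisson structure on $V$ is an $\mathbb R$-bilinear, skew-symmetric bracket $\{\cdot,\cdot\}_V$ on $C^\infty(V)$ satisfying the Jacobi identity and the Leibniz rule. **Proposition.** Let $\mu:(A,\Omega)\to V$ be a symplectic principal $\mathbb R$-bundle.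 Then there exists a unique Poisson structure $\{\cdot,\cdot\}_V$ on $V$ such that $\mu$ is a Poisson map, i.e. $$\{f\circ\mu,f'\circ\mu\}_A=\{f,f'\}_V\circ\mu\qquad\text{for all } f,f'\in C^\infty(V),$$ where $\{\cdot,\cdot\}_A$ is the Poisson bracket on $A$ induced by $\Omega$. -/

import Mathlib

open scoped Manifold ContDiff

noncomputable section

/-- A pointwise alternating two-form on a manifold modelled on `E` (no smoothness is required). -/
abbrev TwoFormField (E : Type*) [NormedAddCommGroup E] [NormedSpace ℝ E]
    (M : Type*) [TopologicalSpace M] [ChartedSpace E M] : Type _ :=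
  ∀ a : M, (TangentSpace 𝓘(ℝ, E) a) [⋀^Fin 2]→L[ℝ] ℝ

/-- The coordinate expression of a two-form in the preferred chart `φ` at `x₀`, that is, the pullback
of the form by `φ⁻¹`. It is meaningful on the open set `(extChartAt 𝓘(ℝ, E) x₀).target` of `E`. -/
def TwoFormField.inChart {E : Type*} [NormedAddCommGroup E] [NormedSpace ℝ E]
    {M : Type*} [TopologicalSpace M] [ChartedSpace E M]
    (Ω : TwoFormField E M) (x₀ : M) (y : E) : E [⋀^Fin 2]→L[ℝ] ℝ :=
  (Ω ((extChartAt 𝓘(ℝ, E) x₀).symm y)).compContinuousLinearMap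
    (mfderiv 𝓘(ℝ, E) 𝓘(ℝ, E) (extChartAt 𝓘(ℝ, E) x₀).symm y)

/-- A symplectic form on a manifold `M` modelled on `E`: a smooth, closed two-form
that is nondegenerate at every point. -/
structure SymplecticForm (E : Type*) [NormedAddCommGroup E] [NormedSpace ℝ E]
    (M : Type*) [TopologicalSpace M] [ChartedSpace E M] where
  toForm : TwoFormField E M
  /-- The coordinate expressions are smooth. -/
  smooth : ∀ x₀ : M, ContDiffOn ℝ ∞ (toForm.inChart x₀) (extChartAt 𝓘(ℝ, E) x₀).target
  /-- `dΩ = 0`, in every chart of the atlas. -/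
  closed : ∀ x₀ : M, ∀ y ∈ (extChartAt 𝓘(ℝ, E) x₀).target, extDeriv (toForm.inChart x₀) y = 0
  nondegenerate : ∀ (a : M) (v : TangentSpace 𝓘(ℝ, E) a),
    (∀ w : TangentSpace 𝓘(ℝ, E) a, toForm a ![v, w] = 0) → v = 0

namespace SymplecticForm

/-- A linear form `α` on a tangent space is `i_v Ω` for exactly one tangent vector `v`. -/
theorem existsUnique_contract_eq {E : Type*} [NormedAddCommGroup E] [NormedSpace ℝ E]
    [FiniteDimensional ℝ E] {M : Type*} [TopologicalSpace M] [ChartedSpace E M]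
    (Ω : SymplecticForm E M) (a : M) (α : TangentSpace 𝓘(ℝ, E) a →L[ℝ] ℝ) :
    ∃! v : TangentSpace 𝓘(ℝ, E) a, ∀ w : TangentSpace 𝓘(ℝ, E) a,
      Ω.toForm a ![v, w] = α w := by
  have : FiniteDimensional ℝ (TangentSpace 𝓘(ℝ, E) a) := inferInstanceAs (FiniteDimensional ℝ E)
  have hupd : ∀ v w : TangentSpace 𝓘(ℝ, E) a, Function.update ![v, 0] 1 w = ![v, w] := by
    intro v w
    ext i
    fin_cases i <;> simp
  let B : TangentSpace 𝓘(ℝ, E) a →ₗ[ℝ] Module.Dual ℝ (TangentSpace 𝓘(ℝ, E) a) :=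
    LinearMap.mk₂ ℝ (fun v w => Ω.toForm a ![v, w])
      (fun v v' w => (Ω.toForm a).toAlternatingMap.map_vecCons_add ![w] v v')
      (fun c v w => (Ω.toForm a).toAlternatingMap.map_vecCons_smul ![w] c v)
      (fun v w w' => by
        have := (Ω.toForm a).map_update_add ![v, 0] 1 w w'
        rwa [hupd, hupd, hupd] at this)
      (fun c v w => by
        have := (Ω.toForm a).map_update_smul ![v, 0] 1 c w
        rwa [hupd, hupd] at this)
  have hinj : Function.Injective B := by
    rw [← LinearMap.ker_eq_bot, LinearMap.ker_eq_bot']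
    exact fun v hv => Ω.nondegenerate a v fun w => LinearMap.congr_fun hv w
  have hsurj : Function.Surjective B :=
    (LinearMap.injective_iff_surjective_of_finrank_eq_finrank
      Subspace.dual_finrank_eq.symm).1 hinj
  obtain ⟨v, hv⟩ := hsurj (α : TangentSpace 𝓘(ℝ, E) a →ₗ[ℝ] ℝ)
  refine ⟨v, fun w => LinearMap.congr_fun hv w, fun v' hv' => hinj ?_⟩
  rw [hv]
  exact LinearMap.ext hv'

variable {E : Type*} [NormedAddCommGroup E] [NormedSpace ℝ E] [FiniteDimensional ℝ E]
  {M : Type*} [TopologicalSpace M] [ChartedSpace E M]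

/-- The Hamiltonian vector field `H_f` of `f`, characterized by `Ω (H_f, w) = df (w)`. -/
def hamiltonianVectorField (Ω : SymplecticForm E M) (f : M → ℝ) (a : M) : TangentSpace 𝓘(ℝ, E) a :=
  (Ω.existsUnique_contract_eq a (mfderiv 𝓘(ℝ, E) 𝓘(ℝ, ℝ) f a)).choose

theorem toForm_hamiltonianVectorField (Ω : SymplecticForm E M) (f : M → ℝ) (a : M)
    (w : TangentSpace 𝓘(ℝ, E) a) :
    Ω.toForm a ![Ω.hamiltonianVectorField f a, w] = mfderiv 𝓘(ℝ, E) 𝓘(ℝ, ℝ) f a w :=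
  (Ω.existsUnique_contract_eq a (mfderiv 𝓘(ℝ, E) 𝓘(ℝ, ℝ) f a)).choose_spec.1 w

/-- The Poisson bracket `{f, g} = Ω (H_f, H_g)` induced by a symplectic form,
so that `{q, p} = 1` for `Ω = dq ∧ dp`. It is used for smooth `f` and `g`. -/
def poissonBracket (Ω : SymplecticForm E M) (f g : M → ℝ) (a : M) : ℝ :=
  Ω.toForm a ![Ω.hamiltonianVectorField f a, Ω.hamiltonianVectorField g a]

end SymplecticForm

/-- A Poisson structure on a manifold `M`: a Lie bracket on the real vector space `C^∞(M)`
that is a derivation in each argument. -/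
@[ext]
structure PoissonStructure (E : Type*) [NormedAddCommGroup E] [NormedSpace ℝ E]
    (M : Type*) [TopologicalSpace M] [ChartedSpace E M] where
  /-- The bracket, an `ℝ`-bilinear map. -/
  bracket : C^∞⟮𝓘(ℝ, E), M; ℝ⟯ →ₗ[ℝ] C^∞⟮𝓘(ℝ, E), M; ℝ⟯ →ₗ[ℝ] C^∞⟮𝓘(ℝ, E), M; ℝ⟯
  skew : ∀ f g, bracket f g = -bracket g f
  jacobi : ∀ f g h,
    bracket f (bracket g h) + bracket g (bracket h f) + bracket h (bracket f g) = 0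
  leibniz : ∀ f g h, bracket f (g * h) = bracket f g * h + g * bracket f h

/-- `μ : A → V` is a (smooth) principal `ℝ`-bundle with principal action the given action of the
additive group `ℝ` on `A`. -/
structure IsPrincipalRBundle (E : Type*) [NormedAddCommGroup E] [NormedSpace ℝ E]
    (F : Type*) [NormedAddCommGroup F] [NormedSpace ℝ F]
    {A : Type*} [TopologicalSpace A] [ChartedSpace E A] [AddAction ℝ A]
    {V : Type*} [TopologicalSpace V] [ChartedSpace F V] (μ : A → V) : Prop where
  contMDiff_proj : ContMDiff 𝓘(ℝ, E) 𝓘(ℝ, F) ∞ μ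
  contMDiff_action :
    ContMDiff (𝓘(ℝ, ℝ).prod 𝓘(ℝ, E)) 𝓘(ℝ, E) ∞ (fun p : ℝ × A => p.1 +ᵥ p.2)
  proj_vadd : ∀ (s : ℝ) (a : A), μ (s +ᵥ a) = μ a
  /-- Around every point of the base there is a smooth trivialization `μ⁻¹(U) ≃ U × ℝ` that is
  equivariant for the translation action of `ℝ` on the second factor. -/
  locally_trivial : ∀ v : V, ∃ e : Bundle.Trivialization ℝ μ, v ∈ e.baseSet ∧
    ContMDiffOn 𝓘(ℝ, E) (𝓘(ℝ, F).prod 𝓘(ℝ, ℝ)) ∞ e e.source ∧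
    ContMDiffOn (𝓘(ℝ, F).prod 𝓘(ℝ, ℝ)) 𝓘(ℝ, E) ∞ e.toOpenPartialHomeomorph.symm e.target ∧
    ∀ a ∈ e.source, ∀ s : ℝ, e (s +ᵥ a) = (μ a, s + (e a).2)

/-- `μ : (A, Ω) → V` is a symplectic principal `ℝ`-bundle: a principal `ℝ`-bundle whose total
space carries a symplectic form `Ω` with `ψ_s^* Ω = Ω` for every `s`, where `ψ_s` is the
principal action. -/
structure IsSymplecticPrincipalRBundle {E : Type*} [NormedAddCommGroup E] [NormedSpace ℝ E]
    (F : Type*) [NormedAddCommGroup F] [NormedSpace ℝ F]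
    {A : Type*} [TopologicalSpace A] [ChartedSpace E A] [AddAction ℝ A]
    {V : Type*} [TopologicalSpace V] [ChartedSpace F V]
    (Ω : SymplecticForm E A) (μ : A → V) : Prop extends IsPrincipalRBundle E F μ where
  symplectic_action : ∀ (s : ℝ) (a : A),
    (Ω.toForm (s +ᵥ a)).compContinuousLinearMap
      (mfderiv 𝓘(ℝ, E) 𝓘(ℝ, E) (fun b : A => s +ᵥ b) a) = Ω.toForm a

end

/-! Functions `f ∘ μ` are invariant under the action, and the action preserves `Ω`, so the bracket
of two of them is invariant as well. The fibres of `μ` are the orbits, hence this bracket is the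
pullback of a function on `V` (`poissonBracket_pullback_eq`), which is smooth because `μ` has smooth
local sections (`contMDiff_of_comp`). As `μ` is surjective, pullback is injective: this gives
uniqueness, and carries each Poisson identity from `A` to `V`.

On `A`, smoothness of the bracket and the Jacobi identity are checked in charts. For Hamiltonian
fields X, Y, Z of a form η, the Jacobi sum is minus the cyclic sum of X(η(Y, Z)). Differentiating
η(X, ·) = df and using symmetry of the Hessian reduces it, up to sign, to dη(X, Y, Z) = 0
(`cyclic_sum_fderiv_twoForm_eq_zero`). -/

/-! ### Two-forms on a vector space. -/

section FlatSpace

open scoped Topology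

variable {E : Type*} [NormedAddCommGroup E] [NormedSpace ℝ E]

/-- A two-form on `E`, as a linear map `E → E'`. -/
noncomputable def twoFormFlat : (E [⋀^Fin 2]→L[ℝ] ℝ) →L[ℝ] (E →L[ℝ] E →L[ℝ] ℝ) :=
  (ContinuousLinearMap.compL ℝ E (E [×1]→L[ℝ] ℝ) (E →L[ℝ] ℝ)
      (continuousMultilinearCurryFin1 ℝ E ℝ).toContinuousLinearEquiv.toContinuousLinearMap).comp
    ((continuousMultilinearCurryLeftEquiv ℝ (fun _ : Fin 2 => E)
      ℝ).toContinuousLinearEquiv.toContinuousLinearMap.comp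
        (ContinuousAlternatingMap.toContinuousMultilinearMapCLM ℝ))

@[simp]
theorem twoFormFlat_apply (η : E [⋀^Fin 2]→L[ℝ] ℝ) (v w : E) :
    twoFormFlat η v w = η ![v, w] := by
  change η _ = _
  congr 1
  ext i
  fin_cases i <;> rfl

theorem contDiff_twoFormFlat {n : ℕ∞ω} :
    ContDiff ℝ n (fun η : E [⋀^Fin 2]→L[ℝ] ℝ => twoFormFlat η) :=
  ContinuousLinearMap.contDiff (𝕜 := ℝ) (E := E [⋀^Fin 2]→L[ℝ] ℝ) (F := E →L[ℝ] E →L[ℝ] ℝ)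
    twoFormFlat

theorem HasFDerivAt.twoFormFlat {G : Type*} [NormedAddCommGroup G] [NormedSpace ℝ G]
    {η : G → E [⋀^Fin 2]→L[ℝ] ℝ} {η' : G →L[ℝ] E [⋀^Fin 2]→L[ℝ] ℝ} {x : G}
    (h : HasFDerivAt η η' x) :
    HasFDerivAt (fun y => _root_.twoFormFlat (η y)) (_root_.twoFormFlat.comp η') x := by
  have h1 : HasFDerivAt (fun w : E [⋀^Fin 2]→L[ℝ] ℝ => _root_.twoFormFlat w)
      (_root_.twoFormFlat) (η x) :=
    ContinuousLinearMap.hasFDerivAt (𝕜 := ℝ) (E := E [⋀^Fin 2]→L[ℝ] ℝ)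
      (F := E →L[ℝ] E →L[ℝ] ℝ) _root_.twoFormFlat
  exact HasFDerivAt.comp (𝕜 := ℝ) (F := E [⋀^Fin 2]→L[ℝ] ℝ) (G := E →L[ℝ] E →L[ℝ] ℝ) x h1 h

theorem ContinuousAlternatingMap.twoForm_swap (η : E [⋀^Fin 2]→L[ℝ] ℝ) (v w : E) :
    η ![v, w] = -η ![w, v] := by
  have h := η.toAlternatingMap.map_swap ![w, v] (i := 0) (j := 1) (by decide)
  have h2 : (![w, v] : Fin 2 → E) ∘ Equiv.swap (0 : Fin 2) 1 = ![v, w] := by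
    ext i
    fin_cases i <;> simp
  rw [h2] at h
  exact h

/-- Inversion is smooth at invertible maps, which is what makes Hamiltonian fields smooth. -/
theorem twoFormFlat_isInvertible [FiniteDimensional ℝ E] {η : E [⋀^Fin 2]→L[ℝ] ℝ}
    (h : ∀ v, (∀ w, η ![v, w] = 0) → v = 0) : (twoFormFlat η).IsInvertible := by
  have hinj : Function.Injective (twoFormFlat η).toLinearMap := by
    rw [← LinearMap.ker_eq_bot, LinearMap.ker_eq_bot']
    intro v hv
    refine h v fun w => ?_
    rw [← twoFormFlat_apply]
    exact congrArg (fun α : E →L[ℝ] ℝ => α w) hv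
  have hdim : Module.finrank ℝ E = Module.finrank ℝ (E →L[ℝ] ℝ) := by
    rw [← (LinearMap.toContinuousLinearMap (𝕜 := ℝ) (E := E) (F' := ℝ)).finrank_eq]
    exact Subspace.dual_finrank_eq.symm
  exact ⟨(LinearEquiv.ofInjectiveOfFinrankEq _ hinj hdim).toContinuousLinearEquiv, by ext; rfl⟩

theorem fderiv_cyclic_of_extDeriv_eq_zero {η : E → E [⋀^Fin 2]→L[ℝ] ℝ} {x : E}
    (hd : extDeriv η x = 0) (u v w : E) :
    fderiv ℝ η x u ![v, w] + fderiv ℝ η x v ![w, u] + fderiv ℝ η x w ![u, v] = 0 := by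
  have h : extDeriv η x ![u, v, w] = 0 := by rw [hd]; rfl
  rw [extDeriv, ContinuousAlternatingMap.alternatizeUncurryFin_apply, Fin.sum_univ_three] at h
  have h0 : (0 : Fin 3).removeNth ![u, v, w] = ![v, w] := by
    ext i; fin_cases i <;> rfl
  have h1 : (1 : Fin 3).removeNth ![u, v, w] = ![u, w] := by
    ext i; fin_cases i <;> rfl
  have h2 : (2 : Fin 3).removeNth ![u, v, w] = ![u, v] := by
    ext i; fin_cases i <;> rfl
  rw [h0, h1, h2] at h
  have h3 := (fderiv ℝ η x v).twoForm_swap u w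
  simp at h
  linarith

/-- If `X`, `Y`, `Z` are the Hamiltonian vector fields of `f`, `g`, `h` with respect to a closed
two-form `η`, then the cyclic sum of the derivatives of `η (Y, Z)` along `X` vanishes. -/
theorem cyclic_sum_fderiv_twoForm_eq_zero {η : E → E [⋀^Fin 2]→L[ℝ] ℝ} {x : E}
    (hη : DifferentiableAt ℝ η x) (hd : extDeriv η x = 0) {f g h : E → ℝ} {X Y Z : E → E}
    (hf : ContDiffAt ℝ 2 f x) (hg : ContDiffAt ℝ 2 g x) (hh : ContDiffAt ℝ 2 h x)
    (hX : DifferentiableAt ℝ X x) (hY : DifferentiableAt ℝ Y x) (hZ : DifferentiableAt ℝ Z x)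
    (hfX : ∀ᶠ y in 𝓝 x, twoFormFlat (η y) (X y) = fderiv ℝ f y)
    (hgY : ∀ᶠ y in 𝓝 x, twoFormFlat (η y) (Y y) = fderiv ℝ g y)
    (hhZ : ∀ᶠ y in 𝓝 x, twoFormFlat (η y) (Z y) = fderiv ℝ h y) :
    fderiv ℝ (fun y => η y ![Y y, Z y]) x (X x) + fderiv ℝ (fun y => η y ![Z y, X y]) x (Y x)
      + fderiv ℝ (fun y => η y ![X y, Y y]) x (Z x) = 0 := by
  have hB : HasFDerivAt (fun y => twoFormFlat (η y)) (twoFormFlat.comp (fderiv ℝ η x)) x :=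
    hη.hasFDerivAt.twoFormFlat
  -- The Hessian of `k`, from the product rule applied to η(W, ·) = dk.
  have flat_deriv : ∀ {k : E → ℝ} {W : E → E}, DifferentiableAt ℝ W x →
      (∀ᶠ y in 𝓝 x, twoFormFlat (η y) (W y) = fderiv ℝ k y) → ∀ u v,
      fderiv ℝ (fderiv ℝ k) x u v
        = fderiv ℝ η x u ![W x, v] + η x ![fderiv ℝ W x u, v] := by
    intro k W hW hk u v
    have := (hB.clm_apply hW.hasFDerivAt).congr_of_eventuallyEq
      (hk.mono fun y hy => hy.symm)
    rw [this.fderiv]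
    simp [add_comm]
  have pair_deriv : ∀ {W W' : E → E}, DifferentiableAt ℝ W x → DifferentiableAt ℝ W' x → ∀ u,
      fderiv ℝ (fun y => η y ![W y, W' y]) x u = fderiv ℝ η x u ![W x, W' x]
        + η x ![fderiv ℝ W x u, W' x] + η x ![W x, fderiv ℝ W' x u] := by
    intro W W' hW hW' u
    have := (hB.clm_apply hW.hasFDerivAt).clm_apply hW'.hasFDerivAt
    simp only [twoFormFlat_apply] at this
    rw [this.fderiv]
    simp
    ring
  have symm : ∀ {k : E → ℝ} {W : E → E}, ContDiffAt ℝ 2 k x → DifferentiableAt ℝ W x →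
      (∀ᶠ y in 𝓝 x, twoFormFlat (η y) (W y) = fderiv ℝ k y) → ∀ u v,
      fderiv ℝ η x u ![W x, v] + η x ![fderiv ℝ W x u, v]
        = fderiv ℝ η x v ![W x, u] + η x ![fderiv ℝ W x v, u] := by
    intro k W hk hW hkW u v
    rw [← flat_deriv hW hkW, ← flat_deriv hW hkW]
    exact (hk.isSymmSndFDerivAt (by simp)) u v
  have cyc := fderiv_cyclic_of_extDeriv_eq_zero hd (X x) (Y x) (Z x)
  have sX := symm hf hX hfX (Y x) (Z x)
  have sY := symm hg hY hgY (Z x) (X x)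
  have sZ := symm hh hZ hhZ (X x) (Y x)
  -- Let S be the cyclic sum of (D_X η)(Y, Z), zero by `cyc`. The terms differentiating X, Y, Z add
  -- up to -2S by `sX`, `sY`, `sZ`, so the total is -S.
  rw [pair_deriv hY hZ, pair_deriv hZ hX, pair_deriv hX hY]
  have a1 := (fderiv ℝ η x (X x)).twoForm_swap (Z x) (Y x)
  have a2 := (fderiv ℝ η x (Y x)).twoForm_swap (X x) (Z x)
  have a3 := (fderiv ℝ η x (Z x)).twoForm_swap (Y x) (X x)
  have b1 := (η x).twoForm_swap (Y x) (fderiv ℝ Z x (X x))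
  have b2 := (η x).twoForm_swap (Z x) (fderiv ℝ X x (Y x))
  have b3 := (η x).twoForm_swap (X x) (fderiv ℝ Y x (Z x))
  linarith

end FlatSpace

theorem TwoFormField.inChart_apply {E : Type*} [NormedAddCommGroup E] [NormedSpace ℝ E]
    {M : Type*} [TopologicalSpace M] [ChartedSpace E M] (Ω : TwoFormField E M) (x₀ : M)
    (y v w : E) :
    Ω.inChart x₀ y ![v, w] = Ω ((extChartAt 𝓘(ℝ, E) x₀).symm y)
      ![mfderiv 𝓘(ℝ, E) 𝓘(ℝ, E) (extChartAt 𝓘(ℝ, E) x₀).symm y v,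
        mfderiv 𝓘(ℝ, E) 𝓘(ℝ, E) (extChartAt 𝓘(ℝ, E) x₀).symm y w] := by
  change Ω _ (mfderiv 𝓘(ℝ, E) 𝓘(ℝ, E) (extChartAt 𝓘(ℝ, E) x₀).symm y ∘ ![v, w]) = _
  congr 1
  ext i
  fin_cases i <;> rfl

/-! ### The Poisson bracket of a symplectic manifold. -/

namespace SymplecticForm

open scoped Topology

variable {E : Type*} [NormedAddCommGroup E] [NormedSpace ℝ E] [FiniteDimensional ℝ E]
  {M : Type*} [TopologicalSpace M] [ChartedSpace E M]

theorem hamiltonianVectorField_eq_of_contract (Ω : SymplecticForm E M) {f : M → ℝ} {a : M}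
    {v : TangentSpace 𝓘(ℝ, E) a}
    (h : ∀ w : TangentSpace 𝓘(ℝ, E) a, Ω.toForm a ![v, w] = mfderiv 𝓘(ℝ, E) 𝓘(ℝ, ℝ) f a w) :
    Ω.hamiltonianVectorField f a = v :=
  (Ω.existsUnique_contract_eq a _).unique (Ω.toForm_hamiltonianVectorField f a) h

/-- In this form, linearity and the Leibniz rule in the first slot are rules for `mfderiv`. -/
theorem poissonBracket_eq_mfderiv (Ω : SymplecticForm E M) (f g : M → ℝ) (a : M) :
    Ω.poissonBracket f g a = mfderiv 𝓘(ℝ, E) 𝓘(ℝ, ℝ) f a (Ω.hamiltonianVectorField g a) :=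
  Ω.toForm_hamiltonianVectorField f a _

theorem poissonBracket_skew (Ω : SymplecticForm E M) (f g : M → ℝ) (a : M) :
    Ω.poissonBracket f g a = -Ω.poissonBracket g f a :=
  (show E [⋀^Fin 2]→L[ℝ] ℝ from Ω.toForm a).twoForm_swap _ _

theorem poissonBracket_add_left (Ω : SymplecticForm E M) {f g h : M → ℝ} {a : M}
    (hf : MDifferentiableAt 𝓘(ℝ, E) 𝓘(ℝ, ℝ) f a) (hg : MDifferentiableAt 𝓘(ℝ, E) 𝓘(ℝ, ℝ) g a) :
    Ω.poissonBracket (f + g) h a = Ω.poissonBracket f h a + Ω.poissonBracket g h a := by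
  simp only [poissonBracket_eq_mfderiv]
  rw [mfderiv_add hf hg]
  rfl

theorem poissonBracket_const_smul_left (Ω : SymplecticForm E M) {f h : M → ℝ} {a : M} (c : ℝ)
    (hf : MDifferentiableAt 𝓘(ℝ, E) 𝓘(ℝ, ℝ) f a) :
    Ω.poissonBracket (c • f) h a = c * Ω.poissonBracket f h a := by
  simp only [poissonBracket_eq_mfderiv]
  rw [const_smul_mfderiv hf c]
  rfl

theorem poissonBracket_mul_left (Ω : SymplecticForm E M) {f g h : M → ℝ} {a : M}
    (hf : MDifferentiableAt 𝓘(ℝ, E) 𝓘(ℝ, ℝ) f a) (hg : MDifferentiableAt 𝓘(ℝ, E) 𝓘(ℝ, ℝ) g a) :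
    Ω.poissonBracket (f * g) h a
      = f a * Ω.poissonBracket g h a + g a * Ω.poissonBracket f h a := by
  simp only [poissonBracket_eq_mfderiv]
  rw [(hf.hasMFDerivAt.mul hg.hasMFDerivAt).mfderiv]
  rfl

/-- The Poisson bracket of functions preserved by a map that preserves the symplectic form is
preserved by that map. -/
theorem poissonBracket_apply_eq_of_invariant (Ω : SymplecticForm E M) {ψ : M → M} {f g : M → ℝ}
    {a : M} (hψ : MDifferentiableAt 𝓘(ℝ, E) 𝓘(ℝ, E) ψ a)
    (hΩ : (Ω.toForm (ψ a)).compContinuousLinearMap (mfderiv 𝓘(ℝ, E) 𝓘(ℝ, E) ψ a) = Ω.toForm a)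
    (hf : MDifferentiableAt 𝓘(ℝ, E) 𝓘(ℝ, ℝ) f (ψ a))
    (hg : MDifferentiableAt 𝓘(ℝ, E) 𝓘(ℝ, ℝ) g (ψ a)) (hfψ : f ∘ ψ = f) (hgψ : g ∘ ψ = g) :
    Ω.poissonBracket f g (ψ a) = Ω.poissonBracket f g a := by
  set L : E →L[ℝ] E := mfderiv 𝓘(ℝ, E) 𝓘(ℝ, E) ψ a with hL
  have hLΩ : ∀ v w : E, Ω.toForm (ψ a) ![L v, L w] = Ω.toForm a ![v, w] := by
    intro v w
    rw [← hΩ]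
    change _ = Ω.toForm (ψ a) (L ∘ ![v, w])
    congr 1
    ext i
    fin_cases i <;> rfl
  -- A linear map preserving a nondegenerate form is injective, hence onto in equal dimension; so
  -- test vectors at `ψ a` may be taken of the form `L w`.
  have hinj : Function.Injective L := by
    refine (injective_iff_map_eq_zero L).2 fun v hv => Ω.nondegenerate a v fun w => ?_
    refine (hLΩ v w).symm.trans ?_
    rw [hv]
    exact (show E [⋀^Fin 2]→L[ℝ] ℝ from Ω.toForm (ψ a)).map_coord_zero 0 rfl
  have hsurj : Function.Surjective L := LinearMap.surjective_of_injective (f := L.toLinearMap) hinj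
  have ham : ∀ {k : M → ℝ}, MDifferentiableAt 𝓘(ℝ, E) 𝓘(ℝ, ℝ) k (ψ a) → k ∘ ψ = k →
      Ω.hamiltonianVectorField k (ψ a) = L (Ω.hamiltonianVectorField k a) := by
    intro k hk hkψ
    refine Ω.hamiltonianVectorField_eq_of_contract fun w => ?_
    obtain ⟨w, rfl⟩ := hsurj w
    have h1 := mfderiv_comp a hk hψ
    rw [hkψ] at h1
    refine (hLΩ _ _).trans ((Ω.toForm_hamiltonianVectorField k a w).trans ?_)
    rw [h1]
    rfl
  rw [poissonBracket, ham hf hfψ, ham hg hgψ]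
  exact hLΩ _ _

/-! ### Hamiltonian fields in charts; smoothness and Jacobi. -/

theorem isInvertible_mfderiv_extChartAt_symm {E : Type*} [NormedAddCommGroup E] [NormedSpace ℝ E]
    {M : Type*} [TopologicalSpace M] [ChartedSpace E M] [IsManifold 𝓘(ℝ, E) ∞ M] {x₀ : M} {y : E}
    (hy : y ∈ (extChartAt 𝓘(ℝ, E) x₀).target) :
    (mfderiv 𝓘(ℝ, E) 𝓘(ℝ, E) (extChartAt 𝓘(ℝ, E) x₀).symm y).IsInvertible := by
  have : IsManifold 𝓘(ℝ, E) 1 M := .of_le (n := ∞) (by simp)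
  have h := isInvertible_mfderivWithin_extChartAt_symm hy
  rwa [modelWithCornersSelf_coe, Set.range_id, mfderivWithin_univ] at h

/-- The Hamiltonian vector field of `f` in the preferred chart at `x₀`. -/
noncomputable def hamiltonianInChart (Ω : SymplecticForm E M) (x₀ : M) (f : M → ℝ) (y : E) : E :=
  -- `inverse` is 0 at non-invertible maps; on the chart target nondegeneracy excludes this.
  (twoFormFlat (Ω.toForm.inChart x₀ y)).inverse
    (fderiv ℝ (f ∘ (extChartAt 𝓘(ℝ, E) x₀).symm) y)

variable [IsManifold 𝓘(ℝ, E) ∞ M]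

theorem inChart_isInvertible (Ω : SymplecticForm E M) {x₀ : M} {y : E}
    (hy : y ∈ (extChartAt 𝓘(ℝ, E) x₀).target) :
    (twoFormFlat (Ω.toForm.inChart x₀ y)).IsInvertible := by
  have hL := isInvertible_mfderiv_extChartAt_symm hy
  refine twoFormFlat_isInvertible fun v hv => ?_
  refine hL.injective (Eq.trans ?_ (map_zero _).symm)
  refine Ω.nondegenerate _ _ fun w => ?_
  obtain ⟨w, rfl⟩ := hL.surjective w
  exact (Ω.toForm.inChart_apply x₀ y v w).symm.trans (hv w)

theorem twoFormFlat_hamiltonianInChart (Ω : SymplecticForm E M) {x₀ : M} {y : E}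
    (hy : y ∈ (extChartAt 𝓘(ℝ, E) x₀).target) (f : M → ℝ) :
    twoFormFlat (Ω.toForm.inChart x₀ y) (Ω.hamiltonianInChart x₀ f y)
      = fderiv ℝ (f ∘ (extChartAt 𝓘(ℝ, E) x₀).symm) y :=
  (Ω.inChart_isInvertible hy).self_apply_inverse _

theorem contDiffOn_hamiltonianInChart (Ω : SymplecticForm E M) (x₀ : M) {f : M → ℝ}
    (hf : ContMDiff 𝓘(ℝ, E) 𝓘(ℝ, ℝ) ∞ f) :
    ContDiffOn ℝ ∞ (Ω.hamiltonianInChart x₀ f) (extChartAt 𝓘(ℝ, E) x₀).target := by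
  have hopen := isOpen_extChartAt_target (I := 𝓘(ℝ, E)) x₀
  have hfc : ContDiffOn ℝ ∞ (f ∘ (extChartAt 𝓘(ℝ, E) x₀).symm) (extChartAt 𝓘(ℝ, E) x₀).target :=
    (hf.comp_contMDiffOn (contMDiffOn_extChartAt_symm x₀)).contDiffOn
  intro y hy
  have h1 := contDiff_twoFormFlat.contDiffAt.comp y ((Ω.smooth x₀).contDiffAt (hopen.mem_nhds hy))
  have h2 := (Ω.inChart_isInvertible hy).contDiffAt_map_inverse (n := ∞)
  have h3 := (hfc.contDiffAt (hopen.mem_nhds hy)).fderiv_right (m := ∞) (by simp)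
  exact ((h2.comp y h1).clm_apply h3).contDiffWithinAt

theorem hamiltonianVectorField_extChartAt_symm (Ω : SymplecticForm E M) {x₀ : M} {y : E}
    (hy : y ∈ (extChartAt 𝓘(ℝ, E) x₀).target) {f : M → ℝ} (hf : ContMDiff 𝓘(ℝ, E) 𝓘(ℝ, ℝ) ∞ f) :
    Ω.hamiltonianVectorField f ((extChartAt 𝓘(ℝ, E) x₀).symm y)
      = mfderiv 𝓘(ℝ, E) 𝓘(ℝ, E) (extChartAt 𝓘(ℝ, E) x₀).symm y (Ω.hamiltonianInChart x₀ f y) := by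
  refine Ω.hamiltonianVectorField_eq_of_contract fun w => ?_
  obtain ⟨w, rfl⟩ := (isInvertible_mfderiv_extChartAt_symm hy).surjective w
  have hcomp : mfderiv 𝓘(ℝ, E) 𝓘(ℝ, ℝ) (f ∘ (extChartAt 𝓘(ℝ, E) x₀).symm) y = _ :=
    mfderiv_comp y (hf.mdifferentiable (by simp) _) ?_
  · refine (Ω.toForm.inChart_apply x₀ y _ w).symm.trans ?_
    refine (twoFormFlat_apply _ _ _).symm.trans ?_
    rw [Ω.twoFormFlat_hamiltonianInChart hy, ← mfderiv_eq_fderiv, hcomp]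
    rfl
  · exact ((contMDiffOn_extChartAt_symm x₀).contMDiffAt
      ((isOpen_extChartAt_target x₀).mem_nhds hy)).mdifferentiableAt (n := ∞) (by simp)

theorem poissonBracket_extChartAt_symm (Ω : SymplecticForm E M) {x₀ : M} {y : E}
    (hy : y ∈ (extChartAt 𝓘(ℝ, E) x₀).target) {f g : M → ℝ} (hf : ContMDiff 𝓘(ℝ, E) 𝓘(ℝ, ℝ) ∞ f)
    (hg : ContMDiff 𝓘(ℝ, E) 𝓘(ℝ, ℝ) ∞ g) :
    Ω.poissonBracket f g ((extChartAt 𝓘(ℝ, E) x₀).symm y)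
      = Ω.toForm.inChart x₀ y ![Ω.hamiltonianInChart x₀ f y, Ω.hamiltonianInChart x₀ g y] := by
  rw [poissonBracket, Ω.hamiltonianVectorField_extChartAt_symm hy hf, Ω.hamiltonianVectorField_extChartAt_symm hy hg,
    TwoFormField.inChart_apply]

theorem contMDiff_poissonBracket (Ω : SymplecticForm E M) {f g : M → ℝ}
    (hf : ContMDiff 𝓘(ℝ, E) 𝓘(ℝ, ℝ) ∞ f) (hg : ContMDiff 𝓘(ℝ, E) 𝓘(ℝ, ℝ) ∞ g) :
    ContMDiff 𝓘(ℝ, E) 𝓘(ℝ, ℝ) ∞ (Ω.poissonBracket f g) := by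
  intro x₀
  have h : ContDiffOn ℝ ∞ (fun y => twoFormFlat (Ω.toForm.inChart x₀ y)
      (Ω.hamiltonianInChart x₀ f y) (Ω.hamiltonianInChart x₀ g y))
      (extChartAt 𝓘(ℝ, E) x₀).target :=
    ((contDiff_twoFormFlat.comp_contDiffOn (Ω.smooth x₀)).clm_apply
      (Ω.contDiffOn_hamiltonianInChart x₀ hf)).clm_apply (Ω.contDiffOn_hamiltonianInChart x₀ hg)
  have h2 := (h.contDiffAt (extChartAt_target_mem_nhds x₀)).contMDiffAt.comp x₀
    (contMDiffAt_extChartAt (I := 𝓘(ℝ, E)) (n := ∞))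
  refine h2.congr_of_eventuallyEq ?_
  filter_upwards [extChartAt_source_mem_nhds (I := 𝓘(ℝ, E)) x₀] with b hb
  have h3 := Ω.poissonBracket_extChartAt_symm ((extChartAt 𝓘(ℝ, E) x₀).map_source hb) hf hg
  rw [(extChartAt 𝓘(ℝ, E) x₀).left_inv hb] at h3
  simpa using h3

theorem poissonBracket_jacobi (Ω : SymplecticForm E M) {f g h : M → ℝ}
    (hf : ContMDiff 𝓘(ℝ, E) 𝓘(ℝ, ℝ) ∞ f) (hg : ContMDiff 𝓘(ℝ, E) 𝓘(ℝ, ℝ) ∞ g)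
    (hh : ContMDiff 𝓘(ℝ, E) 𝓘(ℝ, ℝ) ∞ h) (a : M) :
    Ω.poissonBracket f (Ω.poissonBracket g h) a + Ω.poissonBracket g (Ω.poissonBracket h f) a
      + Ω.poissonBracket h (Ω.poissonBracket f g) a = 0 := by
  set x := extChartAt 𝓘(ℝ, E) a a
  have hx : x ∈ (extChartAt 𝓘(ℝ, E) a).target := mem_extChartAt_target a
  have hxa : (extChartAt 𝓘(ℝ, E) a).symm x = a := extChartAt_to_inv a
  have hnhds := extChartAt_target_mem_nhds (I := 𝓘(ℝ, E)) a
  have hsmooth : ∀ {k : M → ℝ}, ContMDiff 𝓘(ℝ, E) 𝓘(ℝ, ℝ) ∞ k →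
      ContDiffAt ℝ 2 (k ∘ (extChartAt 𝓘(ℝ, E) a).symm) x := fun hk =>
    ((hk.comp_contMDiffOn (contMDiffOn_extChartAt_symm a)).contDiffOn.contDiffAt hnhds).of_le
      (WithTop.coe_le_coe.2 le_top)
  have hham : ∀ {k : M → ℝ}, ContMDiff 𝓘(ℝ, E) 𝓘(ℝ, ℝ) ∞ k →
      DifferentiableAt ℝ (Ω.hamiltonianInChart a k) x := fun hk =>
    ((Ω.contDiffOn_hamiltonianInChart a hk).contDiffAt hnhds).differentiableAt (by simp)
  have hflat : ∀ k : M → ℝ, ∀ᶠ y in 𝓝 x,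
      twoFormFlat (Ω.toForm.inChart a y) (Ω.hamiltonianInChart a k y)
        = fderiv ℝ (k ∘ (extChartAt 𝓘(ℝ, E) a).symm) y := fun k =>
    Filter.mem_of_superset hnhds fun y hy => Ω.twoFormFlat_hamiltonianInChart hy k
  -- {k, m} = -dm(H_k), read in the chart with m = {k₁, k₂}.
  have key : ∀ {k k₁ k₂ : M → ℝ}, ContMDiff 𝓘(ℝ, E) 𝓘(ℝ, ℝ) ∞ k →
      ContMDiff 𝓘(ℝ, E) 𝓘(ℝ, ℝ) ∞ k₁ → ContMDiff 𝓘(ℝ, E) 𝓘(ℝ, ℝ) ∞ k₂ →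
      Ω.poissonBracket k (Ω.poissonBracket k₁ k₂) a = -fderiv ℝ (fun y => Ω.toForm.inChart a y
        ![Ω.hamiltonianInChart a k₁ y, Ω.hamiltonianInChart a k₂ y]) x
          (Ω.hamiltonianInChart a k x) := by
    intro k k₁ k₂ hk hk₁ hk₂
    have h1 := Ω.poissonBracket_extChartAt_symm hx (Ω.contMDiff_poissonBracket hk₁ hk₂) hk
    rw [hxa, ← twoFormFlat_apply, Ω.twoFormFlat_hamiltonianInChart hx] at h1
    rw [poissonBracket_skew, h1]
    congr 2
    refine Filter.EventuallyEq.fderiv_eq ?_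
    filter_upwards [hnhds] with y hy
    exact Ω.poissonBracket_extChartAt_symm hy hk₁ hk₂
  rw [key hf hg hh, key hg hh hf, key hh hf hg]
  have := cyclic_sum_fderiv_twoForm_eq_zero
    (((Ω.smooth a).contDiffAt hnhds).differentiableAt (by simp)) (Ω.closed a x hx)
    (hsmooth hf) (hsmooth hg) (hsmooth hh) (hham hf) (hham hg) (hham hh)
    (hflat f) (hflat g) (hflat h)
  linarith

end SymplecticForm

/-! ### Orbits, local sections and descent of functions. -/

namespace IsPrincipalRBundle

variable {E : Type*} [NormedAddCommGroup E] [NormedSpace ℝ E]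
  {F : Type*} [NormedAddCommGroup F] [NormedSpace ℝ F]
  {A : Type*} [TopologicalSpace A] [ChartedSpace E A] [AddAction ℝ A]
  {V : Type*} [TopologicalSpace V] [ChartedSpace F V] {μ : A → V}

theorem surjective (hμ : IsPrincipalRBundle E F μ) : Function.Surjective μ := by
  intro v
  obtain ⟨e, hv, -⟩ := hμ.locally_trivial v
  exact ⟨_, e.proj_symm_apply' (x := (0 : ℝ)) hv⟩

/-- The action is transitive on the fibres. -/
theorem exists_vadd_eq (hμ : IsPrincipalRBundle E F μ) {a b : A} (h : μ a = μ b) :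
    ∃ s : ℝ, s +ᵥ a = b := by
  obtain ⟨e, hv, -, -, he⟩ := hμ.locally_trivial (μ a)
  have ha : a ∈ e.source := e.mem_source.2 hv
  have hb : b ∈ e.source := e.mem_source.2 (h ▸ hv)
  -- Translation by the difference of the fibre coordinates.
  refine ⟨(e b).2 - (e a).2, e.injOn (e.mem_source.2 ?_) hb ?_⟩
  · rwa [hμ.proj_vadd]
  · change e _ = e b
    rw [he a ha, sub_add_cancel, h, e.mk_proj_snd hb]

theorem contMDiff_vadd (hμ : IsPrincipalRBundle E F μ) (s : ℝ) :
    ContMDiff 𝓘(ℝ, E) 𝓘(ℝ, E) ∞ (fun a : A => s +ᵥ a) :=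
  hμ.contMDiff_action.comp (contMDiff_const.prodMk contMDiff_id)

/-- A function on the base is smooth if its pullback to the total space is. -/
theorem contMDiff_of_comp (hμ : IsPrincipalRBundle E F μ) {k : V → ℝ}
    (hk : ContMDiff 𝓘(ℝ, E) 𝓘(ℝ, ℝ) ∞ (k ∘ μ)) : ContMDiff 𝓘(ℝ, F) 𝓘(ℝ, ℝ) ∞ k := by
  intro v
  obtain ⟨e, hv, -, he, -⟩ := hμ.locally_trivial v
  -- The zero section of the trivialization; near `v`, `k` is `k ∘ μ` along it.
  have h1 : ContMDiffAt 𝓘(ℝ, F) 𝓘(ℝ, E) ∞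
      (fun w : V => e.toOpenPartialHomeomorph.symm (w, (0 : ℝ))) v :=
    ((he _ (e.mem_target.2 hv)).contMDiffAt
      (e.open_target.mem_nhds (e.mem_target.2 hv))).comp v
      (contMDiffAt_id.prodMk contMDiffAt_const)
  refine ((hk _).comp v h1).congr_of_eventuallyEq ?_
  filter_upwards [e.open_baseSet.mem_nhds hv] with w hw
  exact congrArg k (e.proj_symm_apply' hw).symm

theorem contMDiff_pullback (hμ : IsPrincipalRBundle E F μ)
    (f : C^∞⟮𝓘(ℝ, F), V; ℝ⟯) : ContMDiff 𝓘(ℝ, E) 𝓘(ℝ, ℝ) ∞ (f ∘ μ) :=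
  f.contMDiff.comp hμ.contMDiff_proj

theorem mdifferentiable_pullback (hμ : IsPrincipalRBundle E F μ)
    (f : C^∞⟮𝓘(ℝ, F), V; ℝ⟯) : MDifferentiable 𝓘(ℝ, E) 𝓘(ℝ, ℝ) (f ∘ μ) :=
  (hμ.contMDiff_pullback f).mdifferentiable (by simp)

theorem ext_of_pullback (hμ : IsPrincipalRBundle E F μ)
    {f g : C^∞⟮𝓘(ℝ, F), V; ℝ⟯} (h : ∀ a, f (μ a) = g (μ a)) : f = g :=
  ContMDiffMap.ext (hμ.surjective.forall.2 h)

end IsPrincipalRBundle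

/-! ### The bracket on the base. -/

namespace IsSymplecticPrincipalRBundle

variable {E : Type*} [NormedAddCommGroup E] [NormedSpace ℝ E] [FiniteDimensional ℝ E]
  {F : Type*} [NormedAddCommGroup F] [NormedSpace ℝ F]
  {A : Type*} [TopologicalSpace A] [ChartedSpace E A] [AddAction ℝ A]
  {V : Type*} [TopologicalSpace V] [ChartedSpace F V] {μ : A → V} {Ω : SymplecticForm E A}

theorem poissonBracket_pullback_eq (hμ : IsSymplecticPrincipalRBundle F Ω μ)
    (f f' : C^∞⟮𝓘(ℝ, F), V; ℝ⟯) {a b : A} (h : μ a = μ b) :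
    Ω.poissonBracket (f ∘ μ) (f' ∘ μ) a = Ω.poissonBracket (f ∘ μ) (f' ∘ μ) b := by
  obtain ⟨s, rfl⟩ := hμ.exists_vadd_eq h
  have hinv : ∀ k : V → ℝ, (k ∘ μ) ∘ (fun b : A => s +ᵥ b) = k ∘ μ := fun k =>
    funext fun b => congrArg k (hμ.proj_vadd s b)
  exact (Ω.poissonBracket_apply_eq_of_invariant (ψ := fun b : A => s +ᵥ b)
    ((hμ.contMDiff_vadd s).mdifferentiable (by simp) a) (hμ.symplectic_action s a)
    (hμ.mdifferentiable_pullback f _) (hμ.mdifferentiable_pullback f' _) (hinv f) (hinv f')).symm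

variable [IsManifold 𝓘(ℝ, E) ∞ A]

/-- The function on the base whose pullback is the bracket of the pullbacks of `f` and `f'`. -/
noncomputable def baseBracket (hμ : IsSymplecticPrincipalRBundle F Ω μ)
    (f f' : C^∞⟮𝓘(ℝ, F), V; ℝ⟯) : C^∞⟮𝓘(ℝ, F), V; ℝ⟯ :=
  -- The chosen fibre point need not vary continuously; the bracket is constant on fibres.
  ⟨fun v => Ω.poissonBracket (f ∘ μ) (f' ∘ μ) (Function.surjInv hμ.surjective v),
    hμ.contMDiff_of_comp <| by
      convert Ω.contMDiff_poissonBracket (hμ.contMDiff_pullback f) (hμ.contMDiff_pullback f')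
        using 1
      exact funext fun a => hμ.poissonBracket_pullback_eq f f' (Function.surjInv_eq _ _)⟩

theorem baseBracket_apply (hμ : IsSymplecticPrincipalRBundle F Ω μ)
    (f f' : C^∞⟮𝓘(ℝ, F), V; ℝ⟯) (a : A) :
    hμ.baseBracket f f' (μ a) = Ω.poissonBracket (f ∘ μ) (f' ∘ μ) a :=
  hμ.poissonBracket_pullback_eq f f' (Function.surjInv_eq _ _)

theorem baseBracket_comp (hμ : IsSymplecticPrincipalRBundle F Ω μ)
    (f f' : C^∞⟮𝓘(ℝ, F), V; ℝ⟯) :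
    hμ.baseBracket f f' ∘ μ = Ω.poissonBracket (f ∘ μ) (f' ∘ μ) :=
  funext (hμ.baseBracket_apply f f')

theorem baseBracket_skew (hμ : IsSymplecticPrincipalRBundle F Ω μ)
    (f g : C^∞⟮𝓘(ℝ, F), V; ℝ⟯) : hμ.baseBracket f g = -hμ.baseBracket g f := by
  refine hμ.ext_of_pullback fun a => ?_
  change hμ.baseBracket f g (μ a) = -hμ.baseBracket g f (μ a)
  rw [baseBracket_apply, baseBracket_apply, Ω.poissonBracket_skew]

theorem baseBracket_add_left (hμ : IsSymplecticPrincipalRBundle F Ω μ)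
    (f g h : C^∞⟮𝓘(ℝ, F), V; ℝ⟯) :
    hμ.baseBracket (f + g) h = hμ.baseBracket f h + hμ.baseBracket g h := by
  refine hμ.ext_of_pullback fun a => ?_
  change _ = hμ.baseBracket f h (μ a) + hμ.baseBracket g h (μ a)
  simp only [baseBracket_apply]
  exact Ω.poissonBracket_add_left (hμ.mdifferentiable_pullback f a)
    (hμ.mdifferentiable_pullback g a)

theorem baseBracket_smul_left (hμ : IsSymplecticPrincipalRBundle F Ω μ) (c : ℝ)
    (f h : C^∞⟮𝓘(ℝ, F), V; ℝ⟯) : hμ.baseBracket (c • f) h = c • hμ.baseBracket f h := by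
  refine hμ.ext_of_pullback fun a => ?_
  change _ = c * hμ.baseBracket f h (μ a)
  simp only [baseBracket_apply]
  exact Ω.poissonBracket_const_smul_left c (hμ.mdifferentiable_pullback f a)

theorem baseBracket_mul_left (hμ : IsSymplecticPrincipalRBundle F Ω μ)
    (f g h : C^∞⟮𝓘(ℝ, F), V; ℝ⟯) :
    hμ.baseBracket (f * g) h = f * hμ.baseBracket g h + g * hμ.baseBracket f h := by
  refine hμ.ext_of_pullback fun a => ?_
  change _ = f (μ a) * hμ.baseBracket g h (μ a) + g (μ a) * hμ.baseBracket f h (μ a)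
  simp only [baseBracket_apply]
  exact Ω.poissonBracket_mul_left (hμ.mdifferentiable_pullback f a)
    (hμ.mdifferentiable_pullback g a)

theorem baseBracket_jacobi (hμ : IsSymplecticPrincipalRBundle F Ω μ)
    (f g h : C^∞⟮𝓘(ℝ, F), V; ℝ⟯) :
    hμ.baseBracket f (hμ.baseBracket g h) + hμ.baseBracket g (hμ.baseBracket h f)
      + hμ.baseBracket h (hμ.baseBracket f g) = 0 := by
  refine hμ.ext_of_pullback fun a => ?_
  change hμ.baseBracket f (hμ.baseBracket g h) (μ a) + hμ.baseBracket g (hμ.baseBracket h f) (μ a)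
      + hμ.baseBracket h (hμ.baseBracket f g) (μ a) = 0
  -- `baseBracket_comp` turns the inner brackets into brackets on `A`.
  simp only [baseBracket_apply, baseBracket_comp]
  exact Ω.poissonBracket_jacobi (hμ.contMDiff_pullback f) (hμ.contMDiff_pullback g)
    (hμ.contMDiff_pullback h) a

/-- The Poisson structure that the total space of a symplectic principal `ℝ`-bundle induces on the
base. -/
noncomputable def basePoissonStructure (hμ : IsSymplecticPrincipalRBundle F Ω μ) :
    PoissonStructure F V where
  bracket := LinearMap.mk₂ ℝ hμ.baseBracket hμ.baseBracket_add_left hμ.baseBracket_smul_left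
    (fun f g h => by
      rw [hμ.baseBracket_skew, hμ.baseBracket_add_left, neg_add, ← hμ.baseBracket_skew,
        ← hμ.baseBracket_skew])
    (fun c f g => by
      rw [hμ.baseBracket_skew, hμ.baseBracket_smul_left, ← smul_neg, ← hμ.baseBracket_skew])
  skew := hμ.baseBracket_skew
  jacobi := hμ.baseBracket_jacobi
  leibniz f g h := by
    simp only [LinearMap.mk₂_apply]
    rw [hμ.baseBracket_skew, hμ.baseBracket_mul_left, hμ.baseBracket_skew f g,
      hμ.baseBracket_skew f h]
    ring

theorem basePoissonStructure_comp (hμ : IsSymplecticPrincipalRBundle F Ω μ)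
    (f f' : C^∞⟮𝓘(ℝ, F), V; ℝ⟯) :
    Ω.poissonBracket (f ∘ μ) (f' ∘ μ) = hμ.basePoissonStructure.bracket f f' ∘ μ :=
  (hμ.baseBracket_comp f f').symm

end IsSymplecticPrincipalRBundle

theorem proposition3p4
    {E : Type*} [NormedAddCommGroup E] [NormedSpace ℝ E] [FiniteDimensional ℝ E]
    {F : Type*} [NormedAddCommGroup F] [NormedSpace ℝ F] [FiniteDimensional ℝ F]
    {A : Type*} [TopologicalSpace A] [T2Space A] [SecondCountableTopology A]
    [ChartedSpace E A] [IsManifold 𝓘(ℝ, E) ∞ A] [AddAction ℝ A]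
    {V : Type*} [TopologicalSpace V] [T2Space V] [SecondCountableTopology V]
    [ChartedSpace F V] [IsManifold 𝓘(ℝ, F) ∞ V]
    (Ω : SymplecticForm E A) (μ : A → V) (hμ : IsSymplecticPrincipalRBundle F Ω μ) :
    ∃! P : PoissonStructure F V, ∀ (f f' : C^∞⟮𝓘(ℝ, F), V; ℝ⟯),
      Ω.poissonBracket (f ∘ μ) (f' ∘ μ) = P.bracket f f' ∘ μ := by
  refine ⟨hμ.basePoissonStructure, hμ.basePoissonStructure_comp, fun P hP => ?_⟩
  refine PoissonStructure.ext (LinearMap.ext₂ fun f f' => hμ.ext_of_pullback fun a => ?_)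
  exact congrFun ((hP f f').symm.trans (hμ.basePoissonStructure_comp f f')) a
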